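/- For finite simple graphs $H$ and $G$, let $\mathcal N(H,G)$ denote the number of (not necessarily induced) subgraphs of $G$ isomorphic to $H$, and let $\mathrm{ex}(n,H,F)$ be the maximum of $\mathcal N(H,G)$ over all $n$-vertex graphs $G$ that contain no (not necessarily induced) subgraph isomorphic to $F$. Let $S_4=K_{1,3}$ be the star on four vertices. An edge of a graph is color-critical if deleting it decreases the chromatic number. Let $F$ be a finite graph with chromatic number $3$ that has a color-critical edge. Then there is $n_0=n_0(F)$ such that for all $n\ge n_0$, $$\mathrm{ex}(n,S_4,F)=\mathrm{ex}(n,S_4,K_3).$$ Moreover, for all $n\ge n_0$ the exact value is $$\mathrm{ex}(n,S_4,F)=\max\{\mathcal N(S_4,K_{k,n-k}),\ \mathcal N(S_4,K_{k+1,n-k-1})\},\qquad k=\left\lfloor \frac n2-\frac{\sqrt{3n-4}}{2}\right\rfloor .$$ -/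

import Mathlib

namespace GenTuran

open scoped Classical in
/-- The generalized Turan number `ex(n, H, F)`: the largest number of (unlabelled, not necessarily
induced) copies of `H` in an `F`-free graph on `n` vertices. -/
noncomputable def ex (n : ℕ) {V W : Type*} (H : SimpleGraph V) (F : SimpleGraph W) : ℕ :=
  Finset.sup {G : SimpleGraph (Fin n) | F.Free G} (fun G => G.copyCount H)

/-- The edge `e` of `G` is color-critical: deleting it decreases the chromatic number. -/
def IsColorCriticalEdge {W : Type*} (G : SimpleGraph W) (e : Sym2 W) : Prop :=
  e ∈ G.edgeSet ∧ (G.deleteEdges {e}).chromaticNumber < G.chromaticNumber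

/-- The star `S₄` on four vertices. -/
abbrev S4 : SimpleGraph (Fin 4) := SimpleGraph.starGraph 0

/-- The triangle `K₃`. -/
abbrev K3 : SimpleGraph (Fin 3) := SimpleGraph.completeGraph (Fin 3)

/-- The number of copies of `S₄` in the complete bipartite graph `K_{a,b}`. -/
noncomputable def starsInBipartite (a b : ℕ) : ℕ :=
  (completeBipartiteGraph (Fin a) (Fin b)).copyCount S4

/-- `⌊n/2 - √(3n-4)/2⌋`; the real number inside is nonnegative for every `n`. -/
noncomputable def partSize (n : ℕ) : ℕ :=
  ⌊(n : ℝ) / 2 - Real.sqrt (3 * (n : ℝ) - 4) / 2⌋₊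

end GenTuran

/-! A copy of `S₄` is a centre with three of its neighbours, so the count is the sum of `(deg
v).choose 3`. On `K_{a,b}` with `a + b = n` this is a concave quadratic in `p = ab`, with peak at `p
= (n² - 3n + 4)/4`. Solving `a(n - a) = p` gives the root `n/2 - √(3n - 4)/2`, and the best integer
part size is next to it (`maxBipartiteStars_eq`).

Bipartite graphs are `F`-free, which gives the lower bound. For the upper bound, progressive
induction (`starCount_le_maxBipartiteStars_of_dense_case`) reduces to graphs in which every vertex
lies in at least `(n-1).choose 3 / 2` stars. All degrees are then linear in `n`. Since `F` is
bipartite plus one edge inside a class, an edge with many common neighbours would produce a copy of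
`F`, so codegrees of edges are bounded (`card_common_neighbors_lt`). Star counts then force all
degrees close to `n/2` (`degree_bounds`), and such a graph is bipartite
(`exists_bipartition_of_degree_bounds`). As `K₃` also satisfies the hypotheses, both extremal
numbers equal the bipartite maximum. -/

open Finset

namespace GenTuran

/-! ### Copies of the star, counted by centre -/

open scoped Classical in
/-- The number of copies of `S₄`, counted by the degree of the centre. -/
noncomputable def starCount {V : Type*} [Fintype V] (G : SimpleGraph V) : ℕ :=
  ∑ v, (G.degree v).choose 3

/-- The star subgraph with centre `v` and leaf set `T`. -/
def starSubgraph {V : Type*} (G : SimpleGraph V) (v : V) (T : Finset V)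
    (hT : ∀ x ∈ T, G.Adj v x) : G.Subgraph where
  verts := {x | x = v ∨ x ∈ T}
  Adj a b := (a = v ∧ b ∈ T) ∨ (b = v ∧ a ∈ T)
  adj_sub := by
    rintro a b (⟨rfl, h⟩ | ⟨rfl, h⟩)
    · exact hT _ h
    · exact (hT _ h).symm
  edge_vert := by
    rintro a b (⟨rfl, h⟩ | ⟨rfl, h⟩)
    · exact Or.inl rfl
    · exact Or.inr h
  symm := ⟨fun a b h => h.symm⟩

theorem nonempty_iso_starSubgraph {V : Type*} (G : SimpleGraph V) (v : V) (T : Finset V)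
    (hT : ∀ x ∈ T, G.Adj v x) (hc : T.card = 3) :
    Nonempty (S4 ≃g (starSubgraph G v T hT).coe) := by
  classical
  have hv : v ∉ T := fun h => (hT v h).ne rfl
  let e : T ≃ Fin 3 := Finset.equivFinOfCardEq hc
  let f : Fin 4 → (starSubgraph G v T hT).verts :=
    Fin.cons ⟨v, Or.inl rfl⟩ (fun i => ⟨(e.symm i : V), Or.inr (e.symm i).2⟩)
  have hf : Function.Bijective f := by
    constructor
    · rw [Fin.cons_injective_iff]
      refine ⟨?_, ?_⟩
      · rintro ⟨i, hi⟩
        have : ((e.symm i : T) : V) = v := congrArg Subtype.val hi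
        exact hv (this ▸ (e.symm i).2)
      · intro i j h
        have : ((e.symm i : T) : V) = (e.symm j : T) :=
          congrArg (fun z : (starSubgraph G v T hT).verts => (z : V)) h
        exact e.symm.injective (Subtype.ext this)
    · rintro ⟨x, rfl | hx⟩
      · exact ⟨0, rfl⟩
      · exact ⟨(e ⟨x, hx⟩).succ, by simp [f]⟩
  have hne : ∀ i : Fin 3, ((e.symm i : T) : V) ≠ v := fun i h => hv (h ▸ (e.symm i).2)
  have hadj : ∀ a b : Fin 4, (((f a : V) = v ∧ (f b : V) ∈ T) ∨ ((f b : V) = v ∧ (f a : V) ∈ T)) ↔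
      a ≠ b ∧ (a = 0 ∨ b = 0) := by
    intro a b
    refine Fin.cases ?_ (fun i => ?_) a <;> refine Fin.cases ?_ (fun j => ?_) b <;>
      simp [f, hv, hne, (Fin.succ_ne_zero _).symm]
  exact ⟨⟨Equiv.ofBijective f hf, fun {a b} => (hadj a b).trans SimpleGraph.starGraph_adj.symm⟩⟩

theorem exists_eq_starSubgraph {V : Type*} (G : SimpleGraph V) (G' : G.Subgraph)
    (h : Nonempty (S4 ≃g G'.coe)) :
    ∃ (v : V) (T : Finset V) (hT : ∀ x ∈ T, G.Adj v x), T.card = 3 ∧ G' = starSubgraph G v T hT := by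
  classical
  obtain ⟨φ⟩ := h
  have hadj : ∀ a b : Fin 4, G'.Adj (φ a) (φ b) ↔ a ≠ b ∧ (a = 0 ∨ b = 0) := by
    intro a b
    rw [← SimpleGraph.starGraph_adj, ← φ.map_adj_iff, SimpleGraph.Subgraph.coe_adj]
  let g : Fin 3 → V := fun i => φ i.succ
  have hg : Function.Injective g := by
    intro i j hij
    exact Fin.succ_injective _ (φ.injective (Subtype.ext hij))
  have hT : ∀ x ∈ univ.image g, G.Adj (φ 0 : V) x := by
    intro x hx
    obtain ⟨i, -, rfl⟩ := mem_image.1 hx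
    exact G'.adj_sub ((hadj 0 i.succ).2 ⟨(Fin.succ_ne_zero i).symm, Or.inl rfl⟩)
  refine ⟨φ 0, univ.image g, hT, ?_, ?_⟩
  · rw [card_image_of_injective _ hg]; simp
  · ext a b
    · constructor
      · intro ha
        obtain ⟨i, hi⟩ := φ.surjective ⟨a, ha⟩
        have ha' : a = φ i := by rw [hi]
        rw [ha']
        refine Fin.cases (Or.inl rfl) (fun j => Or.inr ?_) i
        exact mem_image.2 ⟨j, mem_univ _, rfl⟩
      · rintro (rfl | ha)
        · exact (φ 0).2
        · obtain ⟨i, -, rfl⟩ := mem_image.1 ha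
          exact (φ i.succ).2
    · constructor
      · intro hab
        obtain ⟨i, hi⟩ := φ.surjective ⟨a, G'.edge_vert hab⟩
        obtain ⟨j, hj⟩ := φ.surjective ⟨b, G'.edge_vert hab.symm⟩
        have ha' : a = φ i := by rw [hi]
        have hb' : b = φ j := by rw [hj]
        rw [ha', hb', hadj] at hab
        rw [ha', hb']
        obtain ⟨hne, rfl | rfl⟩ := hab
        · obtain ⟨k, rfl⟩ := Fin.exists_succ_eq.2 hne.symm
          exact Or.inl ⟨rfl, mem_image.2 ⟨k, mem_univ _, rfl⟩⟩
        · obtain ⟨k, rfl⟩ := Fin.exists_succ_eq.2 hne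
          exact Or.inr ⟨rfl, mem_image.2 ⟨k, mem_univ _, rfl⟩⟩
      · rintro (⟨rfl, hb⟩ | ⟨rfl, hb⟩) <;> obtain ⟨i, -, rfl⟩ := mem_image.1 hb
        · exact (hadj _ _).2 ⟨(Fin.succ_ne_zero i).symm, Or.inl rfl⟩
        · exact (hadj _ _).2 ⟨Fin.succ_ne_zero i, Or.inr rfl⟩

theorem starSubgraph_inj {V : Type*} (G : SimpleGraph V) {v w : V} {T U : Finset V}
    {hT : ∀ x ∈ T, G.Adj v x} {hU : ∀ x ∈ U, G.Adj w x} (hc : T.card = 3)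
    (h : starSubgraph G v T hT = starSubgraph G w U hU) : v = w ∧ T = U := by
  classical
  have hadj : ∀ a b, (a = v ∧ b ∈ T) ∨ (b = v ∧ a ∈ T) ↔ (a = w ∧ b ∈ U) ∨ (b = w ∧ a ∈ U) :=
    fun a b => iff_of_eq (congrArg (fun K : G.Subgraph => K.Adj a b) h)
  have hv : v ∉ T := fun h => (hT v h).ne rfl
  have hw : w ∉ U := fun h => (hU w h).ne rfl
  have hvw : v = w := by
    -- With distinct centres every edge at `v` would have to end at `w`, leaving at most one leaf.
    by_contra hne
    have : T ⊆ {w} := by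
      intro x hx
      rcases (hadj v x).1 (Or.inl ⟨rfl, hx⟩) with h' | h'
      · exact absurd h'.1 hne
      · exact mem_singleton.2 h'.1
    have := card_le_card this
    simp [hc] at this
  subst hvw
  refine ⟨rfl, ?_⟩
  ext x
  have := hadj v x
  constructor
  · intro hx
    rcases this.1 (Or.inl ⟨rfl, hx⟩) with h' | h'
    · exact h'.2
    · exact absurd h'.2 hw
  · intro hx
    rcases this.2 (Or.inl ⟨rfl, hx⟩) with h' | h'
    · exact h'.2
    · exact absurd h'.2 hv

theorem copyCount_S4 {V : Type*} [Fintype V] (G : SimpleGraph V) :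
    G.copyCount S4 = starCount G := by
  classical
  have h1 : starCount G
      = (univ.sigma fun v => (G.neighborFinset v).powersetCard 3).card := by
    rw [card_sigma]
    simp [starCount, card_powersetCard]
  rw [h1, SimpleGraph.copyCount]
  symm
  have hadj : ∀ p : (_ : V) × Finset V,
      p ∈ univ.sigma (fun v => (G.neighborFinset v).powersetCard 3) →
        (∀ x ∈ p.2, G.Adj p.1 x) ∧ p.2.card = 3 := by
    intro p hp
    have := mem_powersetCard.1 (mem_sigma.1 hp).2
    exact ⟨fun x hx => (G.mem_neighborFinset _ _).1 (this.1 hx), this.2⟩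
  refine card_bij (fun p hp => starSubgraph G p.1 p.2 (hadj p hp).1) ?_ ?_ ?_
  · intro p hp
    exact mem_filter.2 ⟨mem_univ _, nonempty_iso_starSubgraph G _ _ _ (hadj p hp).2⟩
  · rintro ⟨v, T⟩ hp ⟨w, U⟩ hq h
    obtain ⟨rfl, rfl⟩ := starSubgraph_inj G (hadj _ hp).2 h
    rfl
  · intro G' hG'
    obtain ⟨v, T, hT, hc, rfl⟩ := exists_eq_starSubgraph G G' (mem_filter.1 hG').2
    exact ⟨⟨v, T⟩, mem_sigma.2 ⟨mem_univ _, mem_powersetCard.2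
      ⟨fun x hx => (G.mem_neighborFinset _ _).2 (hT x hx), hc⟩⟩, rfl⟩

/-! ### Stars in bipartite graphs -/

/-- The number of copies of `S₄` in `K_{a,b}`. -/
def bipartiteStars (a b : ℕ) : ℕ := a * b.choose 3 + b * a.choose 3

theorem starCount_completeBipartiteGraph {A B : Type*} [Fintype A] [Fintype B] :
    starCount (completeBipartiteGraph A B) =
      bipartiteStars (Fintype.card A) (Fintype.card B) := by
  classical
  have h1 : ∀ x : A, (completeBipartiteGraph A B).degree (Sum.inl x) = Fintype.card B := by
    intro x
    rw [← SimpleGraph.card_neighborFinset_eq_degree,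
      show (completeBipartiteGraph A B).neighborFinset (Sum.inl x) = univ.map .inr by
        ext y; rw [SimpleGraph.mem_neighborFinset]; cases y <;> simp]
    simp
  have h2 : ∀ x : B, (completeBipartiteGraph A B).degree (Sum.inr x) = Fintype.card A := by
    intro x
    rw [← SimpleGraph.card_neighborFinset_eq_degree,
      show (completeBipartiteGraph A B).neighborFinset (Sum.inr x) = univ.map .inl by
        ext y; rw [SimpleGraph.mem_neighborFinset]; cases y <;> simp]
    simp
  simp only [starCount, Fintype.sum_sum_type]
  rw [sum_congr rfl (fun x _ => by convert congrArg (Nat.choose · 3) (h1 x)),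
    sum_congr (s₁ := (univ : Finset B)) rfl
      (fun x _ => by convert congrArg (Nat.choose · 3) (h2 x))]
  simp [bipartiteStars]

theorem starsInBipartite_eq (a b : ℕ) : starsInBipartite a b = bipartiteStars a b := by
  rw [starsInBipartite, copyCount_S4, starCount_completeBipartiteGraph]
  simp

theorem starCount_le_of_bipartite {V : Type*} [Fintype V] (G : SimpleGraph V) (A : Set V)
    (h : ∀ x y, G.Adj x y → (x ∈ A ↔ y ∉ A)) :
    ∃ a ≤ Fintype.card V, starCount G ≤ bipartiteStars a (Fintype.card V - a) := by
  classical
  refine ⟨#{x | x ∈ A}, card_le_univ _, ?_⟩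
  have hc : #{x | x ∉ A} = Fintype.card V - #{x | x ∈ A} := by
    have := card_filter_add_card_filter_not (s := (univ : Finset V)) (fun x => x ∈ A)
    rw [card_univ] at this; omega
  rw [starCount, ← sum_filter_add_sum_filter_not univ (fun x => x ∈ A), bipartiteStars]
  gcongr
  · refine (sum_le_card_nsmul _ _ ((Fintype.card V - #{x | x ∈ A}).choose 3) ?_).trans_eq (by simp)
    intro x hx
    refine Nat.choose_le_choose 3 ?_
    rw [← hc, ← SimpleGraph.card_neighborFinset_eq_degree]
    refine card_le_card fun y hy => ?_
    have := h x y ((G.mem_neighborFinset _ _).1 hy)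
    simp_all
  · rw [← hc]
    refine (sum_le_card_nsmul _ _ ((#{x | x ∈ A}).choose 3) ?_).trans_eq (by simp)
    intro x hx
    refine Nat.choose_le_choose 3 ?_
    rw [← SimpleGraph.card_neighborFinset_eq_degree]
    refine card_le_card fun y hy => ?_
    have := h x y ((G.mem_neighborFinset _ _).1 hy)
    simp_all

/-- The largest number of copies of `S₄` in a complete bipartite graph on `n` vertices. -/
def maxBipartiteStars (n : ℕ) : ℕ := (range (n + 1)).sup fun a => bipartiteStars a (n - a)

theorem bipartiteStars_le_max (a b : ℕ) : bipartiteStars a b ≤ maxBipartiteStars (a + b) := by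
  have := le_sup (f := fun c => bipartiteStars c (a + b - c))
    (mem_range.2 (show a < a + b + 1 by omega))
  rwa [Nat.add_sub_cancel_left] at this

theorem exists_eq_maxBipartiteStars (n : ℕ) :
    ∃ a ≤ n, maxBipartiteStars n = bipartiteStars a (n - a) := by
  obtain ⟨a, ha, h⟩ := exists_mem_eq_sup (range (n + 1)) ⟨0, by simp⟩
    fun a => bipartiteStars a (n - a)
  exact ⟨a, by simpa [Nat.lt_succ_iff] using ha, h⟩

theorem cast_choose_two (a : ℕ) : ((a.choose 2 : ℕ) : ℝ) * 2 = a * (a - 1) := by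
  rw [Nat.cast_choose_two]; ring

theorem cast_choose_three (a : ℕ) : ((a.choose 3 : ℕ) : ℝ) * 6 = a * (a - 1) * (a - 2) := by
  induction a with
  | zero => simp
  | succ a ih =>
    rw [Nat.choose_succ_succ' a 2]
    push_cast
    linear_combination ih + 3 * cast_choose_two a

theorem bipartiteStars_mul_six (a b : ℕ) : (bipartiteStars a b : ℝ) * 6 =
    (a * b) * (((a : ℝ) + b) ^ 2 - 3 * (a + b) + 4 - 2 * (a * b)) := by
  rw [bipartiteStars]
  push_cast
  linear_combination a * cast_choose_three b + b * cast_choose_three a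

/-- A vertex joined to the `b`-side creates `b.choose 3 + b * a.choose 2` stars; adding the
symmetric count gives `(a + b).choose 3` by Vandermonde. Hence one of the two extensions gains at
least half of that. -/
theorem bipartiteStars_add (a b : ℕ) : bipartiteStars (a + 1) b + bipartiteStars a (b + 1) =
    2 * bipartiteStars a b + (a + b).choose 3 := by
  have h1 := bipartiteStars_mul_six (a + 1) b
  have h2 := bipartiteStars_mul_six a (b + 1)
  have h3 := bipartiteStars_mul_six a b
  have h4 := cast_choose_three (a + b)
  push_cast at h1 h2 h4
  have : ((bipartiteStars (a + 1) b + bipartiteStars a (b + 1) : ℕ) : ℝ) =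
    ((2 * bipartiteStars a b + (a + b).choose 3 : ℕ) : ℝ) := by
    push_cast
    linear_combination (h1 + h2 - 2 * h3 - h4) / 6
  exact_mod_cast this

theorem two_mul_maxBipartiteStars_add_le (n : ℕ) :
    2 * maxBipartiteStars n + n.choose 3 ≤ 2 * maxBipartiteStars (n + 1) := by
  obtain ⟨a, ha, h⟩ := exists_eq_maxBipartiteStars n
  obtain ⟨b, rfl⟩ := Nat.exists_eq_add_of_le ha
  rw [Nat.add_sub_cancel_left] at h
  have h1 := bipartiteStars_le_max (a + 1) b
  have h2 := bipartiteStars_le_max a (b + 1)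
  have h3 := bipartiteStars_add a b
  rw [show a + 1 + b = a + b + 1 by ring] at h1
  rw [show a + (b + 1) = a + b + 1 by ring] at h2
  omega

theorem bipartiteStars_comm (a b : ℕ) : bipartiteStars a b = bipartiteStars b a :=
  add_comm _ _

/-- The peak is attained exactly at the real number whose floor is `partSize n`, and `a(n - a)`
increases up to `n/2`. So the products for `k` and `k + 1` lie on either side of the peak. -/
theorem partSize_spec {n : ℕ} (hn : 10 ≤ n) :
    2 * partSize n + 2 ≤ n ∧
    (partSize n : ℝ) * (n - partSize n) ≤ ((n : ℝ) ^ 2 - 3 * n + 4) / 4 ∧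
    ((n : ℝ) ^ 2 - 3 * n + 4) / 4 ≤ ((partSize n : ℝ) + 1) * (n - partSize n - 1) := by
  have hn' : (10 : ℝ) ≤ n := by exact_mod_cast hn
  set s := Real.sqrt (3 * (n : ℝ) - 4) with hs
  have hs2 : s ^ 2 = 3 * n - 4 := Real.sq_sqrt (by linarith)
  have hs0 : 0 ≤ s := Real.sqrt_nonneg _
  have hs3 : 4 ≤ s := by nlinarith
  have hsn : s ≤ n := by nlinarith
  have h1 : (partSize n : ℝ) ≤ n / 2 - s / 2 := Nat.floor_le (by linarith)
  have h2 : (n : ℝ) / 2 - s / 2 < partSize n + 1 := Nat.lt_floor_add_one _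
  have h3 : 2 * (partSize n : ℝ) + 2 ≤ n := by linarith
  refine ⟨by exact_mod_cast h3, ?_, ?_⟩ <;> nlinarith

theorem bipartiteStars_le_of_le_of_le {n a b : ℕ} (hab : a ≤ b) (hb : 2 * b ≤ n)
    (h : (b : ℝ) * (n - b) ≤ ((n : ℝ) ^ 2 - 3 * n + 4) / 4) :
    bipartiteStars a (n - a) ≤ bipartiteStars b (n - b) := by
  have h1 := bipartiteStars_mul_six a (n - a)
  have h2 := bipartiteStars_mul_six b (n - b)
  rw [Nat.cast_sub (by omega)] at h1 h2
  have hab' : (a : ℝ) ≤ b := by exact_mod_cast hab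
  have hb' : 2 * (b : ℝ) ≤ n := by exact_mod_cast hb
  have hp : (a : ℝ) * (n - a) ≤ b * (n - b) := by nlinarith
  have : (bipartiteStars a (n - a) : ℝ) ≤ bipartiteStars b (n - b) := by
    nlinarith [mul_nonneg (sub_nonneg.2 hp)
      (show 0 ≤ ((n : ℝ) ^ 2 - 3 * n + 4) - 2 * (a * (n - a)) - 2 * (b * (n - b)) by linarith)]
  exact_mod_cast this

theorem bipartiteStars_le_of_ge_of_le {n a b : ℕ} (hab : a ≤ b) (hb : 2 * b ≤ n)
    (h : ((n : ℝ) ^ 2 - 3 * n + 4) / 4 ≤ (a : ℝ) * (n - a)) :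
    bipartiteStars b (n - b) ≤ bipartiteStars a (n - a) := by
  have h1 := bipartiteStars_mul_six a (n - a)
  have h2 := bipartiteStars_mul_six b (n - b)
  rw [Nat.cast_sub (by omega)] at h1 h2
  have hab' : (a : ℝ) ≤ b := by exact_mod_cast hab
  have hb' : 2 * (b : ℝ) ≤ n := by exact_mod_cast hb
  have hp : (a : ℝ) * (n - a) ≤ b * (n - b) := by nlinarith
  have : (bipartiteStars b (n - b) : ℝ) ≤ bipartiteStars a (n - a) := by
    nlinarith [mul_nonneg (sub_nonneg.2 hp)
      (show 0 ≤ 2 * (a * (n - a)) + 2 * (b * (n - b)) - ((n : ℝ) ^ 2 - 3 * n + 4) by linarith)]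
  exact_mod_cast this

theorem maxBipartiteStars_eq {n : ℕ} (hn : 10 ≤ n) : maxBipartiteStars n =
    max (bipartiteStars (partSize n) (n - partSize n))
      (bipartiteStars (partSize n + 1) (n - partSize n - 1)) := by
  obtain ⟨hk, h1, h2⟩ := partSize_spec hn
  have hsub : n - partSize n - 1 = n - (partSize n + 1) := by omega
  rw [hsub]
  apply le_antisymm
  · have key : ∀ a, 2 * a ≤ n → bipartiteStars a (n - a) ≤
        max (bipartiteStars (partSize n) (n - partSize n))
          (bipartiteStars (partSize n + 1) (n - (partSize n + 1))) := by
      intro a ha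
      rcases Nat.lt_or_ge (partSize n) a with h | h
      · refine le_max_of_le_right (bipartiteStars_le_of_ge_of_le h ha ?_)
        push_cast; linarith
      · exact le_max_of_le_left (bipartiteStars_le_of_le_of_le h (by omega) h1)
    obtain ⟨a, ha, h⟩ := exists_eq_maxBipartiteStars n
    rw [h]
    rcases le_total (2 * a) n with h' | h'
    · exact key a h'
    · rw [bipartiteStars_comm]
      have := key (n - a) (by omega)
      rwa [Nat.sub_sub_self ha] at this
  · have h3 := bipartiteStars_le_max (partSize n) (n - partSize n)
    have h4 := bipartiteStars_le_max (partSize n + 1) (n - (partSize n + 1))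
    rw [Nat.add_sub_cancel' (by omega)] at h3 h4
    exact max_le h3 h4

/-! ### Vertex deletion and progressive induction -/

open scoped Classical in
/-- The number of copies of `S₄` in `G` that use the vertex `v`. -/
noncomputable def starsAt {V : Type*} [Fintype V] (G : SimpleGraph V) (v : V) : ℕ :=
  (G.degree v).choose 3 + ∑ w ∈ G.neighborFinset v, (G.degree w - 1).choose 2

/-- Deleting `v` lowers the degree of each neighbour by one, and Pascal's rule gives the stars lost
there. -/
theorem starCount_eq_comap_add_starsAt {n : ℕ} (G : SimpleGraph (Fin (n + 1))) (v : Fin (n + 1)) :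
    starCount G = starCount (G.comap v.succAbove) + starsAt G v := by
  classical
  have hdeg : ∀ {m : ℕ} (H : SimpleGraph (Fin m)) (w : Fin m),
      H.degree w = ∑ x, if H.Adj w x then 1 else 0 := by
    intro m H w
    rw [← SimpleGraph.card_neighborFinset_eq_degree, SimpleGraph.neighborFinset_eq_filter,
      card_filter]
  obtain ⟨K, hK⟩ : ∃ K, K = G.comap v.succAbove := ⟨_, rfl⟩
  rw [← hK]
  have h1 : ∀ i : Fin n, G.degree (v.succAbove i) =
      (if G.Adj v (v.succAbove i) then 1 else 0) + K.degree i := by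
    intro i
    rw [hdeg, hdeg, Fin.sum_univ_succAbove _ v]
    simp [hK, SimpleGraph.adj_comm]
  have h2 : ∑ w ∈ G.neighborFinset v, (G.degree w - 1).choose 2 =
      ∑ i : Fin n, if G.Adj v (v.succAbove i) then (G.degree (v.succAbove i) - 1).choose 2
        else 0 := by
    rw [SimpleGraph.neighborFinset_eq_filter, sum_filter, Fin.sum_univ_succAbove _ v]
    simp
  have h3 : ∀ i : Fin n, (G.degree (v.succAbove i)).choose 3 =
      (K.degree i).choose 3 +
      if G.Adj v (v.succAbove i) then (G.degree (v.succAbove i) - 1).choose 2 else 0 := by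
    intro i
    rw [h1]
    split_ifs
    · rw [add_comm 1, Nat.choose_succ_succ' _ 2, Nat.add_sub_cancel, add_comm]
    · simp
  have h4 : starCount G = (G.degree v).choose 3 +
      ∑ i : Fin n, (G.degree (v.succAbove i)).choose 3 := Fin.sum_univ_succAbove _ v
  rw [h4, sum_congr rfl fun i _ => h3 i, sum_add_distrib, starsAt, h2, starCount]
  ring

theorem free_comap {U V W : Type*} {F : SimpleGraph W} {G : SimpleGraph V} (f : U ↪ V)
    (h : F.Free G) : F.Free (G.comap f) := fun h' =>
  h (h'.trans ⟨(SimpleGraph.Embedding.comap f G).toCopy⟩)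

theorem starCount_le_maxBipartiteStars_of_dense_case {W : Type*} (F : SimpleGraph W) (n₁ : ℕ)
    (hF : ∀ n, n₁ ≤ n → ∀ G : SimpleGraph (Fin n), F.Free G →
      (∀ v, (n - 1).choose 3 ≤ 2 * starsAt G v) → starCount G ≤ maxBipartiteStars n) :
    ∃ n₀, ∀ n, n₀ ≤ n → ∀ G : SimpleGraph (Fin n), F.Free G →
      starCount G ≤ maxBipartiteStars n := by
  classical
  -- Deleting a vertex in few stars costs strictly less than the bipartite maximum drops. So any
  -- excess over that maximum shrinks by at least one per added vertex, from an initial excess of at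
  -- most `n₁ * n₁.choose 3`.
  have key : ∀ j, ∀ G : SimpleGraph (Fin (n₁ + j)), F.Free G →
      starCount G ≤ maxBipartiteStars (n₁ + j) ∨
      starCount G + j ≤ maxBipartiteStars (n₁ + j) + n₁ * n₁.choose 3 := by
    intro j
    induction j with
    | zero =>
      intro G _
      right
      have : starCount G ≤ n₁ * n₁.choose 3 := by
        refine (sum_le_card_nsmul _ _ (n₁.choose 3) fun v _ => Nat.choose_le_choose 3 ?_).trans_eq
          (by simp)
        exact (G.degree_lt_card_verts v).le.trans_eq (by simp)
      omega
    | succ j ih =>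
      change ∀ G : SimpleGraph (Fin (n₁ + j + 1)), F.Free G →
        starCount G ≤ maxBipartiteStars (n₁ + j + 1) ∨
        starCount G + (j + 1) ≤ maxBipartiteStars (n₁ + j + 1) + n₁ * n₁.choose 3
      intro G hG
      by_cases h : ∀ v, (n₁ + j + 1 - 1).choose 3 ≤ 2 * starsAt G v
      · exact Or.inl (hF _ (by omega) G hG h)
      · push Not at h
        obtain ⟨v, hv⟩ := h
        rw [show n₁ + j + 1 - 1 = n₁ + j from rfl] at hv
        have h1 := starCount_eq_comap_add_starsAt (n := n₁ + j) G v
        have h2 := two_mul_maxBipartiteStars_add_le (n₁ + j)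
        have h3 := ih _ (free_comap (Fin.succAboveEmb (n := n₁ + j) v) hG)
        change starCount (G.comap (Fin.succAbove (n := n₁ + j) v)) ≤ _ ∨
          starCount (G.comap (Fin.succAbove (n := n₁ + j) v)) + _ ≤ _ at h3
        omega
  refine ⟨n₁ + n₁ * n₁.choose 3, fun n hn G hG => ?_⟩
  obtain ⟨j, rfl⟩ := Nat.exists_eq_add_of_le (show n₁ ≤ n by omega)
  have := key j G hG
  omega

/-! ### Embedding `F` around an edge of large codegree -/

theorem exists_coloring_of_critical_edge {W : Type*} (F : SimpleGraph W)
    (hF : F.chromaticNumber = 3) (hcrit : ∃ e : Sym2 W, IsColorCriticalEdge F e) :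
    ∃ (c : W → Bool) (a b : W), a ≠ b ∧ c a = true ∧ c b = true ∧
      ∀ u v, F.Adj u v → s(u, v) ≠ s(a, b) → c u ≠ c v := by
  obtain ⟨e, he, hlt⟩ := hcrit
  induction e with | _ a b =>
  rw [hF] at hlt
  have hle : (F.deleteEdges {s(a, b)}).chromaticNumber ≤ (2 : ℕ) :=
    Order.le_of_lt_add_one (by exact_mod_cast hlt)
  obtain ⟨C⟩ := SimpleGraph.chromaticNumber_le_iff_colorable.1 hle
  have hC : ∀ u v, F.Adj u v → s(u, v) ≠ s(a, b) → C u ≠ C v := fun u v h hne =>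
    C.valid (by simpa [SimpleGraph.deleteEdges_adj] using ⟨h, by simpa using hne⟩)
  -- Otherwise `C` would properly 2-colour all of `F`.
  have hab : C a = C b := by
    by_contra hne
    have : F.Colorable 2 := ⟨SimpleGraph.Coloring.mk C fun {u v} h => by
      by_cases huv : s(u, v) = s(a, b)
      · rcases Sym2.eq_iff.1 huv with ⟨rfl, rfl⟩ | ⟨rfl, rfl⟩
        · exact hne
        · exact Ne.symm hne
      · exact hC u v h huv⟩
    have := SimpleGraph.chromaticNumber_le_iff_colorable.2 this
    rw [hF] at this
    exact absurd this (by decide)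
  refine ⟨fun w => decide (C w = C a), a, b, SimpleGraph.Adj.ne he, by simp, by simp [hab], ?_⟩
  intro u v h hne
  have := hC u v h hne
  simp only [ne_eq, decide_eq_decide]
  omega

theorem isContained_of_complete_bipartite_add_edge {V W : Type*} [Fintype W]
    {F : SimpleGraph W} {G : SimpleGraph V}
    {c : W → Bool} {a b : W} (hab : a ≠ b) (ha : c a = true) (hb : c b = true)
    (hc : ∀ u v, F.Adj u v → s(u, v) ≠ s(a, b) → c u ≠ c v)
    {x y : V} (hxy : G.Adj x y) {A B : Finset V} (hA : Fintype.card W ≤ A.card)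
    (hB : Fintype.card W ≤ B.card) (hxA : x ∉ A) (hyA : y ∉ A)
    (hxB : ∀ z ∈ B, G.Adj x z) (hyB : ∀ z ∈ B, G.Adj y z)
    (hAB : ∀ w ∈ A, ∀ z ∈ B, G.Adj w z) : F.IsContained G := by
  classical
  obtain ⟨f⟩ := Function.Embedding.nonempty_of_card_le
    (show Fintype.card W ≤ Fintype.card A by simpa using hA)
  obtain ⟨g⟩ := Function.Embedding.nonempty_of_card_le
    (show Fintype.card W ≤ Fintype.card B by simpa using hB)
  -- The class of `a` and `b` goes into `A` except that `ab` lands on `xy`; the other class goes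
  -- into `B`.
  let l : W → V := fun u => if u = a then x else if u = b then y else f u
  have hl : ∀ u, ∀ z ∈ B, G.Adj (l u) z := by
    intro u z hz
    simp only [l]
    split_ifs
    · exact hxB z hz
    · exact hyB z hz
    · exact hAB _ (f u).2 z hz
  have hli : Function.Injective l := by
    intro u v h
    have h1 : ∀ w, (f w : V) ≠ x := fun w h => hxA (h ▸ (f w).2)
    have h2 : ∀ w, (f w : V) ≠ y := fun w h => hyA (h ▸ (f w).2)
    have h3 := hxy.ne
    simp only [l] at h
    split_ifs at h
    · exact (‹u = a›).trans (‹v = a›).symm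
    · exact absurd h h3
    · exact absurd h.symm (h1 _)
    · exact absurd h.symm h3
    · exact (‹u = b›).trans (‹v = b›).symm
    · exact absurd h.symm (h2 _)
    · exact absurd h (h1 _)
    · exact absurd h (h2 _)
    · exact f.injective (Subtype.ext h)
  let φ : W → V := fun u => if c u = true then l u else g u
  have hφl : ∀ u, c u = true → φ u = l u := fun u h => if_pos h
  have hφg : ∀ u, c u = false → φ u = g u := fun u h => if_neg (by simp [h])
  refine ⟨⟨⟨φ, ?_⟩, ?_⟩⟩
  · intro u v h
    by_cases huv : s(u, v) = s(a, b)
    · have hla : φ a = x := by rw [hφl a ha]; simp [l]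
      have hlb : φ b = y := by rw [hφl b hb]; simp [l, hab.symm]
      rcases Sym2.eq_iff.1 huv with ⟨rfl, rfl⟩ | ⟨rfl, rfl⟩
      · rw [hla, hlb]; exact hxy
      · rw [hla, hlb]; exact hxy.symm
    · have hne := hc u v h huv
      cases hu : c u <;> cases hv : c v
      · simp [hu, hv] at hne
      · rw [hφg u hu, hφl v hv]; exact (hl _ _ (g u).2).symm
      · rw [hφl u hu, hφg v hv]; exact hl _ _ (g v).2
      · simp [hu, hv] at hne
  · intro u v h
    change φ u = φ v at h
    cases hu : c u <;> cases hv : c v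
    · rw [hφg u hu, hφg v hv] at h; exact g.injective (Subtype.ext h)
    · rw [hφg u hu, hφl v hv] at h; exact absurd h (hl v _ (g u).2).ne'
    · rw [hφl u hu, hφg v hv] at h; exact absurd h (hl u _ (g v).2).ne
    · rw [hφl u hu, hφl v hv] at h; exact hli h

open scoped Classical in
/-- A dense bipartite graph with a bounded side contains a large complete bipartite graph. -/
theorem exists_complete_bipartite {V : Type*} [Fintype V] (G : SimpleGraph V) {m : ℕ} (hm : 0 < m)
    (hdeg : ∀ v, Fintype.card V ≤ 16 * G.degree v)
    (hn : 32 * (2 ^ (32 * m) * (m + 2)) < Fintype.card V) (T : Finset V) (hT : T.card = 32 * m) :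
    ∃ A B : Finset V, m + 2 < A.card ∧ B.card = m ∧ B ⊆ T ∧ ∀ w ∈ A, ∀ z ∈ B, G.Adj w z := by
  set n := Fintype.card V
  let R : Finset V := {v | m ≤ #{z ∈ T | G.Adj v z}}
  have hsum : ∑ v, #{z ∈ T | G.Adj v z} = ∑ z ∈ T, G.degree z := by
    have := sum_card_bipartiteAbove_eq_sum_card_bipartiteBelow G.Adj (s := univ) (t := T)
    simp only [bipartiteAbove, bipartiteBelow] at this
    rw [this]
    refine sum_congr rfl fun z _ => ?_
    rw [← SimpleGraph.card_neighborFinset_eq_degree, SimpleGraph.neighborFinset_eq_filter]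
    simp [SimpleGraph.adj_comm]
  have hlow : 2 * m * n ≤ ∑ z ∈ T, G.degree z := by
    have : ∑ z ∈ T, n ≤ ∑ z ∈ T, 16 * G.degree z := sum_le_sum fun z _ => hdeg z
    rw [sum_const, ← mul_sum, smul_eq_mul, hT] at this
    linarith
  have hup : ∑ v, #{z ∈ T | G.Adj v z} ≤ n * m + #R * (32 * m) := by
    calc ∑ v, #{z ∈ T | G.Adj v z} ≤ ∑ v, (m + if v ∈ R then 32 * m else 0) := by
          refine sum_le_sum fun v _ => ?_
          split_ifs with h
          · exact (card_filter_le _ _).trans (by omega)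
          · simp only [R, mem_filter, mem_univ, true_and] at h; omega
      _ = n * m + #R * (32 * m) := by
          rw [sum_add_distrib, sum_const, card_univ, smul_eq_mul, ← sum_filter, sum_const,
            smul_eq_mul]
          simp [n]
  -- Vertices have on average at least `2m` neighbours in `T`, so a fixed proportion of them has at
  -- least `m`. Pigeonhole over the subsets of `T` then gives many vertices sharing the same `m`
  -- neighbours.
  have hR : n ≤ 32 * #R := by
    rw [hsum] at hup
    have h1 := hlow.trans hup
    exact Nat.le_of_mul_le_mul_left (by linarith : m * n ≤ m * (32 * #R)) hm
  have hch : ∀ v, ∃ B : Finset V, v ∈ R → B ⊆ {z ∈ T | G.Adj v z} ∧ B.card = m := by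
    intro v
    by_cases hv : v ∈ R
    · obtain ⟨B, hB⟩ := exists_subset_card_eq (mem_filter.1 hv).2
      exact ⟨B, fun _ => hB⟩
    · exact ⟨∅, fun h => absurd h hv⟩
  choose f hf using hch
  obtain ⟨B, hB, hlt⟩ := exists_lt_card_fiber_of_mul_lt_card_of_maps_to
    (s := R) (t := T.powerset) (f := f) (n := m + 2)
    (fun v hv => mem_powerset.2 ((hf v hv).1.trans (filter_subset _ _)))
    (by rw [card_powerset, hT]; omega)
  have hne : ({v ∈ R | f v = B}).Nonempty := card_pos.1 (by omega)
  obtain ⟨v, hv⟩ := hne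
  obtain ⟨hvR, rfl⟩ := mem_filter.1 hv
  refine ⟨{w ∈ R | f w = f v}, f v, hlt, (hf v hvR).2, mem_powerset.1 hB, ?_⟩
  intro w hw z hz
  obtain ⟨hw, hwv⟩ := mem_filter.1 hw
  rw [← hwv] at hz
  exact (mem_filter.1 ((hf w hw).1 hz)).2

open scoped Classical in
theorem card_common_neighbors_lt {W : Type*} [Fintype W] (F : SimpleGraph W)
    (hF : F.chromaticNumber = 3) (hcrit : ∃ e : Sym2 W, IsColorCriticalEdge F e)
    {V : Type*} [Fintype V] (G : SimpleGraph V) (hG : F.Free G)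
    (hdeg : ∀ v, Fintype.card V ≤ 16 * G.degree v)
    (hn : 32 * (2 ^ (32 * Fintype.card W) * (Fintype.card W + 2)) < Fintype.card V)
    {x y : V} (hxy : G.Adj x y) :
    #(G.neighborFinset x ∩ G.neighborFinset y) < 32 * Fintype.card W := by
  obtain ⟨c, a, b, hab, ha, hb, hc⟩ := exists_coloring_of_critical_edge F hF hcrit
  by_contra! h
  obtain ⟨T, hT, hTc⟩ := exists_subset_card_eq h
  obtain ⟨A, B, hA, hB, hBT, hAB⟩ := exists_complete_bipartite G
    (Fintype.card_pos_iff.2 ⟨a⟩) hdeg hn T hTc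
  have hxyB : ∀ z ∈ B, G.Adj x z ∧ G.Adj y z := fun z hz => by
    simpa using hT (hBT hz)
  refine hG (isContained_of_complete_bipartite_add_edge hab ha hb hc hxy
    (A := (A.erase x).erase y) (B := B) ?_ hB.ge (by simp) (by simp)
    (fun z hz => (hxyB z hz).1) (fun z hz => (hxyB z hz).2)
    (fun w hw => hAB w (mem_of_mem_erase (mem_of_mem_erase hw))))
  -- The surplus of two in `A` pays for removing `x` and `y`.
  have h1 := pred_card_le_card_erase (s := A) (a := x)
  have h2 := pred_card_le_card_erase (s := A.erase x) (a := y)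
  omega

/-! ### Degrees near `n/2` and bipartiteness -/

open scoped Classical in
theorem cube_le_of_starsAt {V : Type*} [Fintype V] (G : SimpleGraph V) {v : V}
    (h : (Fintype.card V - 1).choose 3 ≤ 2 * starsAt G v) :
    (Fintype.card V : ℝ) ^ 3 / 2 - 3 * (Fintype.card V : ℝ) ^ 2 ≤
      (G.degree v : ℝ) ^ 3 + 3 * ∑ w ∈ G.neighborFinset v, (G.degree w : ℝ) ^ 2 := by
  have hpos : 1 ≤ Fintype.card V := Fintype.card_pos_iff.2 ⟨v⟩
  have h1 := cast_choose_three (Fintype.card V - 1)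
  have h2 : (((G.degree v).choose 3 : ℕ) : ℝ) * 6 ≤ (G.degree v : ℝ) ^ 3 := by
    rw [cast_choose_three]
    rcases Nat.eq_zero_or_pos (G.degree v) with h0 | h0
    · simp [h0]
    · have : (1 : ℝ) ≤ G.degree v := by exact_mod_cast h0
      nlinarith
  have h3 : ∀ w, (((G.degree w - 1).choose 2 : ℕ) : ℝ) * 2 ≤ (G.degree w : ℝ) ^ 2 := by
    intro w
    have : (((G.degree w - 1).choose 2 : ℕ) : ℝ) ≤ ((G.degree w).choose 2 : ℕ) := by
      exact_mod_cast Nat.choose_le_choose 2 (Nat.sub_le _ _)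
    have := cast_choose_two (G.degree w)
    have : (0 : ℝ) ≤ G.degree w := Nat.cast_nonneg _
    nlinarith
  have h4 : (((Fintype.card V - 1).choose 3 : ℕ) : ℝ) ≤ 2 * (((G.degree v).choose 3 : ℕ) +
      ∑ w ∈ G.neighborFinset v, (((G.degree w - 1).choose 2 : ℕ) : ℝ)) := by
    have : (((Fintype.card V - 1).choose 3 : ℕ) : ℝ) ≤ ((2 * starsAt G v : ℕ) : ℝ) := by
      exact_mod_cast h
    simpa [starsAt] using this
  have h5 : (∑ w ∈ G.neighborFinset v, (((G.degree w - 1).choose 2 : ℕ) : ℝ)) * 2 ≤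
      ∑ w ∈ G.neighborFinset v, (G.degree w : ℝ) ^ 2 := by
    rw [sum_mul]
    exact sum_le_sum fun w _ => h3 w
  rw [Nat.cast_sub hpos] at h1
  push_cast at h1
  have : (1 : ℝ) ≤ Fintype.card V := by exact_mod_cast hpos
  nlinarith

open scoped Classical in
theorem cube_le_of_degree_le {V : Type*} [Fintype V] (G : SimpleGraph V) {v : V} {D : ℝ}
    (hD : ∀ w, (G.degree w : ℝ) ≤ D)
    (h : (Fintype.card V - 1).choose 3 ≤ 2 * starsAt G v) :
    (Fintype.card V : ℝ) ^ 3 / 2 - 3 * (Fintype.card V : ℝ) ^ 2 ≤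
      (G.degree v : ℝ) ^ 3 + 3 * (G.degree v * D ^ 2) := by
  refine (cube_le_of_starsAt G h).trans ?_
  gcongr
  have : ∑ w ∈ G.neighborFinset v, (G.degree w : ℝ) ^ 2 ≤ ∑ w ∈ G.neighborFinset v, D ^ 2 :=
    sum_le_sum fun w _ => pow_le_pow_left₀ (Nat.cast_nonneg _) (hD w) 2
  simpa using this

open scoped Classical in
theorem card_le_sixteen_mul_degree {V : Type*} [Fintype V] (G : SimpleGraph V)
    (hn : 12 ≤ Fintype.card V) {v : V}
    (h : (Fintype.card V - 1).choose 3 ≤ 2 * starsAt G v) :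
    Fintype.card V ≤ 16 * G.degree v := by
  have hle : ∀ w, (G.degree w : ℝ) ≤ Fintype.card V := fun w => by
    exact_mod_cast (G.degree_lt_card_verts w).le
  have h1 := cube_le_of_degree_le G hle h
  have h2 := hle v
  have hn' : (12 : ℝ) ≤ Fintype.card V := by exact_mod_cast hn
  set n : ℝ := (Fintype.card V : ℝ) with hnd
  set d : ℝ := (G.degree v : ℝ) with hd
  have hd0 : 0 ≤ d := Nat.cast_nonneg _
  have h3 : d ^ 3 ≤ d * n ^ 2 := by
    have := mul_le_mul_of_nonneg_left (pow_le_pow_left₀ hd0 h2 2) hd0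
    linarith [show d * d ^ 2 = d ^ 3 by ring]
  have h4 : n ^ 2 * (n / 2 - 3) ≤ n ^ 2 * (4 * d) := by nlinarith
  have h5 := le_of_mul_le_mul_left h4 (by positivity)
  have : (Fintype.card V : ℝ) ≤ 16 * (G.degree v : ℝ) := by linarith
  exact_mod_cast this

open scoped Classical in
theorem degree_add_degree_le {V : Type*} [Fintype V] (G : SimpleGraph V) (x y : V) :
    G.degree x + G.degree y ≤
      Fintype.card V + #(G.neighborFinset x ∩ G.neighborFinset y) := by
  have h1 := card_union_add_card_inter (G.neighborFinset x) (G.neighborFinset y)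
  have h2 := card_le_univ (G.neighborFinset x ∪ G.neighborFinset y)
  simp only [SimpleGraph.card_neighborFinset_eq_degree] at h1
  omega

open scoped Classical in
theorem degree_bounds {V : Type*} [Fintype V] (G : SimpleGraph V) {t : ℕ}
    (hn : 10 ^ 7 * (t + 1) ≤ Fintype.card V)
    (hcod : ∀ x y, G.Adj x y → #(G.neighborFinset x ∩ G.neighborFinset y) ≤ t)
    (hst : ∀ v, (Fintype.card V - 1).choose 3 ≤ 2 * starsAt G v) (v : V) :
    48 / 100 * (Fintype.card V : ℝ) ≤ G.degree v ∧
      (G.degree v : ℝ) ≤ 51 / 100 * Fintype.card V := by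
  obtain ⟨u, -, hu⟩ := exists_max_image (univ : Finset V) (fun w => G.degree w) ⟨v, mem_univ _⟩
  have hD : ∀ w, (G.degree w : ℝ) ≤ G.degree u := fun w => by
    exact_mod_cast hu w (mem_univ _)
  have hn' : (10 : ℝ) ^ 7 * (t + 1) ≤ Fintype.card V := by exact_mod_cast hn
  have ht0 : (0 : ℝ) ≤ t := Nat.cast_nonneg _
  -- If the maximum degree `D` were larger, a neighbour `w` of `u` would have degree at most `n + t
  -- - D`. The identity `h4` shows that `w` then lies in too few stars, by a cubic margin.
  have hmax : (G.degree u : ℝ) ≤ 51 / 100 * Fintype.card V := by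
    by_contra! hlt
    have hpos : 0 < G.degree u := by
      have : (0 : ℝ) < G.degree u := by linarith
      exact_mod_cast this
    obtain ⟨w, hw⟩ := (G.degree_pos_iff_exists_adj u).1 hpos
    have h1 := cube_le_of_degree_le G hD (hst w)
    have h2 : (G.degree w : ℝ) ≤ Fintype.card V + t - G.degree u := by
      have h3 := degree_add_degree_le G u w
      have h4 := hcod u w hw
      have : (G.degree u : ℝ) + G.degree w ≤ Fintype.card V + t := by
        exact_mod_cast h3.trans (by omega)
      linarith
    set n : ℝ := (Fintype.card V : ℝ) with hnd
    set D : ℝ := (G.degree u : ℝ)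
    set q : ℝ := (G.degree w : ℝ)
    have hq0 : 0 ≤ q := Nat.cast_nonneg _
    have h3 : q ^ 3 + 3 * (q * D ^ 2) ≤ (n + t - D) ^ 3 + 3 * ((n + t - D) * D ^ 2) := by
      gcongr
    have h4 : (n + t - D) ^ 3 + 3 * ((n + t - D) * D ^ 2) =
        (n + t) ^ 3 / 2 - 4 * (D - (n + t) / 2) ^ 3 := by ring
    have h5 : 9 / 1000 * n ≤ D - (n + t) / 2 := by linarith
    have h6 := pow_le_pow_left₀ (by linarith) h5 3
    have hn0 : 0 < n := by linarith
    have htn : (t : ℝ) ≤ n := by linarith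
    have h7 : (n + t) ^ 3 ≤ n ^ 3 + n ^ 2 * (7 * t) := by
      have a1 : (t : ℝ) * t ≤ n * t := mul_le_mul_of_nonneg_right htn ht0
      have a2 : (n : ℝ) * (t * t) ≤ n * (n * t) := mul_le_mul_of_nonneg_left a1 hn0.le
      have a3 : (t : ℝ) * (t * t) ≤ n * (n * t) :=
        mul_le_mul htn a1 (mul_nonneg ht0 ht0) hn0.le
      linarith [show (n + t) ^ 3 = n ^ 3 + 3 * (n * (n * t)) + 3 * (n * (t * t)) + t * (t * t) by ring,
        show n ^ 2 * (7 * t) = 7 * (n * (n * t)) by ring]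
    have h8 : n ^ 2 * (4 * (9 / 1000) ^ 3 * n) ≤ n ^ 2 * (7 / 2 * t + 3) := by
      linarith [show n ^ 2 * (4 * (9 / 1000) ^ 3 * n) = 4 * (9 / 1000 * n) ^ 3 by ring]
    have h9 := le_of_mul_le_mul_left h8 (by positivity)
    norm_num at h9 hn'
    linarith
  refine ⟨?_, (hD v).trans hmax⟩
  have h1 := cube_le_of_degree_le G (fun w => (hD w).trans hmax) (hst v)
  have h2 := (hD v).trans hmax
  set n : ℝ := (Fintype.card V : ℝ) with hnd
  set d : ℝ := (G.degree v : ℝ)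
  have hd0 : 0 ≤ d := Nat.cast_nonneg _
  have hn0 : 0 < n := by linarith
  have h3 : d ^ 3 ≤ d * (51 / 100 * n) ^ 2 := by
    have := mul_le_mul_of_nonneg_left (pow_le_pow_left₀ hd0 h2 2) hd0
    linarith [show d * d ^ 2 = d ^ 3 by ring]
  have h4 : n ^ 2 * (n / 2 - 3) ≤ n ^ 2 * (4 * (51 / 100) ^ 2 * d) := by
    linarith [show n ^ 2 * (n / 2 - 3) = n ^ 3 / 2 - 3 * n ^ 2 by ring,
      show n ^ 2 * (4 * (51 / 100) ^ 2 * d) = 4 * (d * (51 / 100 * n) ^ 2) by ring]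
  have h5 := le_of_mul_le_mul_left h4 (by positivity)
  norm_num at h5 hn'
  linarith

open scoped Classical in
/-- A graph whose degrees are all close to `n / 2` and whose edges have small codegree is
bipartite. -/
theorem exists_bipartition_of_degree_bounds {V : Type*} [Fintype V] (G : SimpleGraph V) {t : ℕ}
    (hn : 10 ^ 7 * (t + 1) ≤ Fintype.card V)
    (hcod : ∀ x y, G.Adj x y → #(G.neighborFinset x ∩ G.neighborFinset y) ≤ t)
    (hdeg : ∀ v, 48 / 100 * (Fintype.card V : ℝ) ≤ G.degree v ∧
      (G.degree v : ℝ) ≤ 51 / 100 * Fintype.card V) :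
    ∃ A : Set V, ∀ x y, G.Adj x y → (x ∈ A ↔ y ∉ A) := by
  have hn' : (10 : ℝ) ^ 7 * (t + 1) ≤ Fintype.card V := by exact_mod_cast hn
  norm_num at hn'
  have hpos : 0 < Fintype.card V := lt_of_lt_of_le (by positivity) hn
  obtain ⟨u⟩ := Fintype.card_pos_iff.1 hpos
  -- A common neighbour `w` has a neighbourhood almost disjoint from those of `x` and `u`, which
  -- squeezes the latter two into little more than `n/2` vertices.
  have hdich : ∀ x, (G.neighborFinset x ∩ G.neighborFinset u).Nonempty →
      43 / 100 * (Fintype.card V : ℝ) ≤ #(G.neighborFinset x ∩ G.neighborFinset u) := by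
    rintro x ⟨w, hw⟩
    simp only [mem_inter, SimpleGraph.mem_neighborFinset] at hw
    have h1 := card_union_add_card_inter (G.neighborFinset x) (G.neighborFinset u)
    have h2 := card_union_add_card_inter (G.neighborFinset x ∪ G.neighborFinset u)
      (G.neighborFinset w)
    have h3 := card_le_univ (G.neighborFinset x ∪ G.neighborFinset u ∪ G.neighborFinset w)
    have h4 := card_union_le (G.neighborFinset x ∩ G.neighborFinset w)
      (G.neighborFinset u ∩ G.neighborFinset w)
    rw [← union_inter_distrib_right] at h4
    have h5 := hcod x w hw.1
    have h6 := hcod u w hw.2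
    simp only [SimpleGraph.card_neighborFinset_eq_degree] at h1 h2
    have h7 : G.degree x + G.degree u + G.degree w ≤
        Fintype.card V + 2 * t + #(G.neighborFinset x ∩ G.neighborFinset u) := by omega
    have h8 : (G.degree x : ℝ) + G.degree u + G.degree w ≤
        Fintype.card V + 2 * t + #(G.neighborFinset x ∩ G.neighborFinset u) := by
      exact_mod_cast h7
    linarith [(hdeg x).1, (hdeg u).1, (hdeg w).1]
  refine ⟨{x | (G.neighborFinset x ∩ G.neighborFinset u).Nonempty}, fun x y hxy => ?_⟩
  have hc : (#(G.neighborFinset x ∩ G.neighborFinset y) : ℝ) ≤ t := by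
    exact_mod_cast hcod x y hxy
  simp only [Set.mem_ofPred_eq]
  constructor
  -- Two subsets of `N(u)` of size `0.43n` overlap in more than `t` vertices.
  · intro hx hy
    have h1 := card_union_add_card_inter (G.neighborFinset x ∩ G.neighborFinset u)
      (G.neighborFinset y ∩ G.neighborFinset u)
    have h2 : #(G.neighborFinset x ∩ G.neighborFinset u ∪ G.neighborFinset y ∩ G.neighborFinset u) ≤
        G.degree u := by
      rw [← SimpleGraph.card_neighborFinset_eq_degree]
      exact card_le_card (union_subset inter_subset_right inter_subset_right)
    have h3 : #(G.neighborFinset x ∩ G.neighborFinset u ∩ (G.neighborFinset y ∩ G.neighborFinset u))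
        ≤ #(G.neighborFinset x ∩ G.neighborFinset y) :=
      card_le_card (inter_subset_inter inter_subset_left inter_subset_left)
    have h4 : (#(G.neighborFinset x ∩ G.neighborFinset u) : ℝ) +
        #(G.neighborFinset y ∩ G.neighborFinset u) ≤
        G.degree u + #(G.neighborFinset x ∩ G.neighborFinset y) := by
      exact_mod_cast (by omega)
    linarith [hdich x hx, hdich y hy, (hdeg u).2]
  -- Otherwise three neighbourhoods of size `0.48n` would be almost pairwise disjoint.
  · intro hy
    by_contra hx
    rw [not_nonempty_iff_eq_empty] at hx hy
    have h1 := card_union_add_card_inter (G.neighborFinset x ∪ G.neighborFinset y)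
      (G.neighborFinset u)
    rw [union_inter_distrib_right, hx, hy] at h1
    have h2 := card_le_univ (G.neighborFinset x ∪ G.neighborFinset y ∪ G.neighborFinset u)
    have h3 := card_union_add_card_inter (G.neighborFinset x) (G.neighborFinset y)
    simp only [SimpleGraph.card_neighborFinset_eq_degree, union_empty, card_empty] at h1 h3
    have h4 : (G.degree x : ℝ) + G.degree y + G.degree u ≤
        Fintype.card V + #(G.neighborFinset x ∩ G.neighborFinset y) := by
      exact_mod_cast (by omega)
    linarith [(hdeg x).1, (hdeg y).1, (hdeg u).1]

/-! ### The extremal number -/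

theorem starCount_le_maxBipartiteStars {W : Type*} [Finite W] (F : SimpleGraph W)
    (hF : F.chromaticNumber = 3) (hcrit : ∃ e : Sym2 W, IsColorCriticalEdge F e) :
    ∃ n₀, ∀ n, n₀ ≤ n → ∀ G : SimpleGraph (Fin n), F.Free G →
      starCount G ≤ maxBipartiteStars n := by
  classical
  cases nonempty_fintype W
  refine starCount_le_maxBipartiteStars_of_dense_case F
    -- The first term serves the degree estimates with `t = 32 * Fintype.card W`; the second, with
    -- the final `+ 1`, serves the pigeonhole bound.
    (10 ^ 7 * (32 * Fintype.card W + 1) +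
      32 * (2 ^ (32 * Fintype.card W) * (Fintype.card W + 2)) + 1) fun n hn G hG hst => ?_
  have hcard : Fintype.card (Fin n) = n := Fintype.card_fin n
  have hst' : ∀ v, (Fintype.card (Fin n) - 1).choose 3 ≤ 2 * starsAt G v := by rwa [hcard]
  have hlarge : 10 ^ 7 * (32 * Fintype.card W + 1) ≤ Fintype.card (Fin n) := by omega
  have hcod : ∀ x y, G.Adj x y →
      #(G.neighborFinset x ∩ G.neighborFinset y) ≤ 32 * Fintype.card W := fun x y hxy => by
    have := card_common_neighbors_lt F hF hcrit G hG
      (fun v => card_le_sixteen_mul_degree G (by omega) (hst' v)) (by omega) hxy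
    convert Nat.le_of_lt this
  obtain ⟨A, hA⟩ := exists_bipartition_of_degree_bounds G hlarge
    (fun x y hxy => by convert hcod x y hxy)
    (degree_bounds G hlarge (fun x y hxy => by convert hcod x y hxy) hst')
  obtain ⟨a, ha, h⟩ := starCount_le_of_bipartite G A hA
  rw [hcard] at ha h
  refine h.trans ?_
  have := bipartiteStars_le_max a (n - a)
  rwa [Nat.add_sub_cancel' ha] at this

theorem maxBipartiteStars_le_ex {W : Type*} (F : SimpleGraph W) (hF : F.chromaticNumber = 3)
    (n : ℕ) : maxBipartiteStars n ≤ ex n S4 F := by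
  classical
  obtain ⟨a, ha, h⟩ := exists_eq_maxBipartiteStars n
  rw [h]
  let e : Fin a ⊕ Fin (n - a) ≃ Fin n :=
    finSumFinEquiv.trans (finCongr (Nat.add_sub_cancel' ha))
  let K := completeBipartiteGraph (Fin a) (Fin (n - a))
  have hfree : F.Free (K.map e.toEmbedding) := by
    rintro ⟨f⟩
    have hcol : F.Colorable 2 := by
      refine SimpleGraph.Colorable.of_hom ((SimpleGraph.Iso.map e K).symm.toHom.comp f.toHom) ?_
      exact (SimpleGraph.CompleteBipartiteGraph.bicoloring (Fin a) (Fin (n - a))).colorable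
    have := SimpleGraph.chromaticNumber_le_iff_colorable.2 hcol
    rw [hF] at this
    exact absurd this (by decide)
  have hcount : (K.map e.toEmbedding).copyCount S4 = bipartiteStars a (n - a) := by
    rw [copyCount_S4]
    have := starCount_completeBipartiteGraph (A := Fin a) (B := Fin (n - a))
    simp only [Fintype.card_fin] at this
    rw [← this]
    refine (Fintype.sum_equiv e _ _ fun v => ?_).symm
    congr 1
    convert! ((SimpleGraph.Iso.map e K).degree_eq v).symm
  rw [← hcount]
  exact le_sup (f := fun G : SimpleGraph (Fin n) => G.copyCount S4)
    (mem_filter.2 ⟨mem_univ _, hfree⟩)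

theorem ex_S4_eq {W : Type*} [Finite W] (F : SimpleGraph W)
    (hF : F.chromaticNumber = 3) (hcrit : ∃ e : Sym2 W, IsColorCriticalEdge F e) :
    ∃ n₀, ∀ n, n₀ ≤ n → ex n S4 F = maxBipartiteStars n := by
  classical
  obtain ⟨n₀, h⟩ := starCount_le_maxBipartiteStars F hF hcrit
  refine ⟨n₀, fun n hn => le_antisymm ?_ (maxBipartiteStars_le_ex F hF n)⟩
  refine Finset.sup_le fun G hG => ?_
  rw [copyCount_S4]
  exact h n hn G (mem_filter.1 hG).2

theorem chromaticNumber_K3 : K3.chromaticNumber = 3 := by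
  simp

theorem exists_isColorCriticalEdge_K3 : ∃ e : Sym2 (Fin 3), IsColorCriticalEdge K3 e := by
  refine ⟨s(0, 1), by simp, ?_⟩
  rw [chromaticNumber_K3]
  have hcol : (K3.deleteEdges {s(0, 1)}).Colorable 2 :=
    ⟨SimpleGraph.Coloring.mk (fun v => if v = 2 then 1 else 0) fun {u v} h => by
      revert h
      fin_cases u <;> fin_cases v <;> simp [SimpleGraph.deleteEdges_adj]⟩
  refine (SimpleGraph.chromaticNumber_le_iff_colorable.2 hcol).trans_lt ?_
  decide

end GenTuran

theorem mainTheorem10 {W : Type*} [Finite W] (F : SimpleGraph W)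
    (hF : F.chromaticNumber = 3) (hcrit : ∃ e : Sym2 W, GenTuran.IsColorCriticalEdge F e) :
    ∃ n₀ : ℕ, ∀ n : ℕ, n₀ ≤ n →
      GenTuran.ex n GenTuran.S4 F = GenTuran.ex n GenTuran.S4 GenTuran.K3 ∧
      GenTuran.ex n GenTuran.S4 F =
        max (GenTuran.starsInBipartite (GenTuran.partSize n) (n - GenTuran.partSize n))
          (GenTuran.starsInBipartite (GenTuran.partSize n + 1) (n - GenTuran.partSize n - 1)) := by
  obtain ⟨n₁, h₁⟩ := GenTuran.ex_S4_eq F hF hcrit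
  obtain ⟨n₂, h₂⟩ := GenTuran.ex_S4_eq GenTuran.K3 GenTuran.chromaticNumber_K3
    GenTuran.exists_isColorCriticalEdge_K3
  refine ⟨max (max n₁ n₂) 10, fun n hn => ?_⟩
  have hn₁ : n₁ ≤ n := ((le_max_left _ _).trans (le_max_left _ _)).trans hn
  have hn₂ : n₂ ≤ n := ((le_max_right _ _).trans (le_max_left _ _)).trans hn
  rw [h₁ n hn₁, h₂ n hn₂, GenTuran.starsInBipartite_eq, GenTuran.starsInBipartite_eq]
  exact ⟨rfl, GenTuran.maxBipartiteStars_eq ((le_max_right _ _).trans hn)⟩
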